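/- Proposition 3.3. Let $\widetilde H$, $V$ and $H$ be complex Hilbert spaces, where $V$ is continuously and densely embedded into $\widetilde H$, and let $j \colon V \to H$ be a bounded linear map with dense range. Let $\mathfrak a \colon V \times V \to \mathbb C$ be a sesquilinear form that is - continuous: there is an $M \ge 0$ with $|\mathfrak a(u,v)| \le M \|u\|_V \|v\|_V$ for all $u,v \in V$; - quasi-coercive: there are $\omega \in \mathbb R$ and $\mu > 0$ with $\operatorname{Re} \mathfrak a(u,u) + \omega \|u\|_{\widetilde H}^2 \ge \mu \|u\|_V^2$ for all $u \in V$; - accretive: $\operatorname{Re} \mathfrak a(u,u) \ge 0$ for all $u \in V$; - $j$-elliptic: there are $\omega \in \mathbb R$ and $\mu > 0$ with $\operatorname{Re} \mathfrak a(u,u) + \omega \|j(u)\|_H^2 \ge \mu \|u\|_V^2$ for all $u \in V$. Let $\widetilde A$ be the operator associated with $\mathfrak a$ in $\widetilde H$, i.e. $u \in D(\widetilde A)$ and $\widetilde A u = f$ if and only if $u \in V$ and $\mathfrak a(u,v) = (f,v)_{\widetilde H}$ for all $v \in V$. Let $A$ be the operator associated with $(\mathfrak a, j)$ in $H$, i.e.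 $\varphi \in D(A)$ and $A\varphi = \psi$ if and only if there is a $u \in V$ with $j(u) = \varphi$ and $\mathfrak a(u,v) = (\psi, j(v))_H$ for all $v \in V$. Let $\widetilde S = (\widetilde S(t))_{t \ge 0}$ and $S = (S(t))_{t \ge 0}$ be the strongly continuous semigroups generated by $-\widetilde A$ on $\widetilde H$ and by $-A$ on $H$. Let $\widetilde{\mathcal C} \subset \widetilde H$ and $\mathcal C \subset H$ be non-empty closed convex sets, with projections (nearest-point maps) $\widetilde P \colon \widetilde H \to \widetilde{\mathcal C}$ and $P \colon H \to \mathcal C$. Suppose that $\widetilde{\mathcal C}$ is invariant under $\widetilde S$, i.e. $\widetilde S(t)\widetilde{\mathcal C} \subset \widetilde{\mathcal C}$ for all $t \ge 0$, and that $P \circ j = j \circ \widetilde P$, i.e. $P(j(u)) = j(\widetilde P u)$ for all $u \in V$ with $\widetilde P u \in V$ (the invariance of $\widetilde{\mathcal C}$ implies $\widetilde P V \subset V$). Then $\mathcal C$ is invariant under $S$, i.e. $S(t)\mathcal C \subset \mathcal C$ for all $t \ge 0$. -/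

import Mathlib

open Filter Topology

namespace FormInvariance

section Forms

variable {V : Type*} [NormedAddCommGroup V] [InnerProductSpace ℂ V]
variable {H : Type*} [NormedAddCommGroup H] [InnerProductSpace ℂ H]

/-- A sesquilinear form `a : V × V → ℂ` (linear in the first, conjugate-linear in the second
argument) is continuous if `|a(u,v)| ≤ M ‖u‖ ‖v‖` for some constant `M ≥ 0`. -/
def IsContinuousForm (a : V →ₗ[ℂ] V →ₗ⋆[ℂ] ℂ) : Prop :=
  ∃ M : ℝ, 0 ≤ M ∧ ∀ u v : V, ‖a u v‖ ≤ M * ‖u‖ * ‖v‖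

/-- `Re a(u,u) ≥ 0` for all `u`. -/
def IsAccretiveForm (a : V →ₗ[ℂ] V →ₗ⋆[ℂ] ℂ) : Prop :=
  ∀ u : V, 0 ≤ (a u u).re

/-- `a` is `j`-elliptic: `Re a(u,u) + ω ‖j u‖² ≥ μ ‖u‖²` for some `ω ∈ ℝ` and `μ > 0`.
When `j` is the embedding of `V` into an ambient space, this is quasi-coercivity of `a`. -/
def IsEllipticForm (a : V →ₗ[ℂ] V →ₗ⋆[ℂ] ℂ) (j : V →L[ℂ] H) : Prop :=
  ∃ ω μ : ℝ, 0 < μ ∧ ∀ u : V, μ * ‖u‖ ^ 2 ≤ (a u u).re + ω * ‖j u‖ ^ 2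

/-- The graph of the operator `A` associated with `(a, j)`: `φ ∈ D(A)` and `A φ = ψ` if and only
if there is `u ∈ V` with `j u = φ` and `a(u,v) = (ψ, j v)` for all `v ∈ V`. (Mathlib's inner product
is conjugate-linear in its first argument, so `(ψ, j v)` is written `inner ℂ (j v) ψ`.)
When `j` is injective, regarded as an inclusion, this is the usual operator associated with `a`. -/
def IsAssociatedOperator (a : V →ₗ[ℂ] V →ₗ⋆[ℂ] ℂ) (j : V →L[ℂ] H) (φ ψ : H) : Prop :=
  ∃ u : V, j u = φ ∧ ∀ v : V, a u v = inner ℂ (j v) ψ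

/-- The operator associated with `(a, j)` is single-valued if `a` is `j`-elliptic and `j` has dense
range. -/
theorem IsAssociatedOperator.unique {a : V →ₗ[ℂ] V →ₗ⋆[ℂ] ℂ} {j : V →L[ℂ] H}
    (ha : IsEllipticForm a j) (hj : DenseRange j) {φ ψ ψ' : H}
    (h : IsAssociatedOperator a j φ ψ) (h' : IsAssociatedOperator a j φ ψ') : ψ = ψ' := by
  obtain ⟨u, hu, hau⟩ := h
  obtain ⟨u', hu', hau'⟩ := h'
  obtain ⟨ω, μ, hμ, hell⟩ := ha
  have hj0 : j (u - u') = 0 := by rw [map_sub, hu, hu', sub_self]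
  have haw : a (u - u') (u - u') = 0 := by
    rw [map_sub a u u', LinearMap.sub_apply, hau, hau', hj0, inner_zero_left, inner_zero_left,
      sub_zero]
  have h1 := hell (u - u')
  rw [haw, hj0] at h1
  have h2 : ‖u - u'‖ ^ 2 ≤ 0 := by
    by_contra hc
    push Not at hc
    have := mul_pos hμ hc
    simp at h1
    linarith
  have h3 : u = u' := by
    have h4 : ‖u - u'‖ = 0 := pow_eq_zero_iff (two_ne_zero) |>.mp (le_antisymm h2 (sq_nonneg _))
    exact sub_eq_zero.mp (norm_eq_zero.mp h4)
  subst h3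
  have hcl : (fun x : H => (inner ℂ x ψ : ℂ)) = fun x => inner ℂ x ψ' := by
    refine hj.equalizer (by fun_prop) (by fun_prop) ?_
    funext v
    exact (hau v).symm.trans (hau' v)
  exact ext_inner_left ℂ fun x => congrFun hcl x

end Forms

section Semigroups

variable {H : Type*} [NormedAddCommGroup H] [InnerProductSpace ℂ H]

/-- `(S t)_{t ≥ 0}` is a strongly continuous semigroup of bounded operators on `H`.
The values `S t` for `t < 0` are irrelevant. -/
structure IsC0Semigroup (S : ℝ → H →L[ℂ] H) : Prop where
  zero : S 0 = ContinuousLinearMap.id ℂ H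
  add : ∀ s t : ℝ, 0 ≤ s → 0 ≤ t → S (s + t) = (S s).comp (S t)
  strongly_continuous : ∀ x : H, ContinuousOn (fun t => S t x) (Set.Ici 0)

/-- The graph of the generator of `S`: `x` lies in the domain, and is sent to `y`, if and only if
`(S t x - x) / t → y` as `t ↓ 0`. -/
def IsGeneratorOf (S : ℝ → H →L[ℂ] H) (x y : H) : Prop :=
  Tendsto (fun t : ℝ => t⁻¹ • (S t x - x)) (𝓝[>] 0) (𝓝 y)

/-- `S` is the strongly continuous semigroup generated by `-A`, where the operator `A` is given by
its graph: `A x y` means `x ∈ D(A)` and `A x = y`. -/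
def IsSemigroupGeneratedByNeg (A : H → H → Prop) (S : ℝ → H →L[ℂ] H) : Prop :=
  IsC0Semigroup S ∧ ∀ x y : H, IsGeneratorOf S x y ↔ A x (-y)

/-- `S(t) C ⊆ C` for all `t ≥ 0`. -/
def IsInvariantUnder (C : Set H) (S : ℝ → H →L[ℂ] H) : Prop :=
  ∀ t : ℝ, 0 ≤ t → ∀ x ∈ C, S t x ∈ C

end Semigroups

section Projection

variable {H : Type*} [NormedAddCommGroup H] [InnerProductSpace ℂ H]

/-- The projection onto a non-empty closed convex subset `C` of a Hilbert space: `metricProj C x` is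
the point of `C` nearest to `x`. -/
noncomputable def metricProj (C : Set H) (x : H) : H :=
  Classical.epsilon fun p => p ∈ C ∧ ∀ y ∈ C, ‖x - p‖ ≤ ‖x - y‖

/-- On a non-empty closed convex set, `metricProj C x` is a nearest point. -/
theorem metricProj_spec [CompleteSpace H] {C : Set H} (hne : C.Nonempty) (hcl : IsClosed C)
    (hco : Convex ℝ C) (x : H) :
    metricProj C x ∈ C ∧ ∀ y ∈ C, ‖x - metricProj C x‖ ≤ ‖x - y‖ := by
  have hex : ∃ p, p ∈ C ∧ ∀ y ∈ C, ‖x - p‖ ≤ ‖x - y‖ := by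
    let _ : InnerProductSpace ℝ H := InnerProductSpace.complexToReal
    obtain ⟨p, hp, hpx⟩ := exists_norm_eq_iInf_of_complete_convex hne hcl.isComplete hco x
    refine ⟨p, hp, fun y hy => ?_⟩
    rw [hpx]
    exact ciInf_le ⟨0, by rintro _ ⟨z, rfl⟩; exact norm_nonneg _⟩ (⟨y, hy⟩ : C)
  exact Classical.epsilon_spec hex

/-- The nearest point of a convex set is unique. -/
theorem eq_metricProj [CompleteSpace H] {C : Set H} (hcl : IsClosed C)
    (hco : Convex ℝ C) {x p : H} (hp : p ∈ C) (hmin : ∀ y ∈ C, ‖x - p‖ ≤ ‖x - y‖) :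
    p = metricProj C x := by
  obtain ⟨hq, hqmin⟩ := metricProj_spec ⟨p, hp⟩ hcl hco x
  set q := metricProj C x
  have hm : (1 / 2 : ℝ) • p + (1 / 2 : ℝ) • q ∈ C :=
    hco hp hq (by norm_num) (by norm_num) (by norm_num)
  have h1 := hmin _ hm
  have h2 : ‖x - p‖ = ‖x - q‖ := le_antisymm (hmin q hq) (hqmin p hp)
  have h3 := parallelogram_law_with_norm ℂ (x - p) (x - q)
  have h4 : (x - p) + (x - q) = (2 : ℝ) • (x - ((1 / 2 : ℝ) • p + (1 / 2 : ℝ) • q)) := by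
    module
  rw [h4, norm_smul, h2] at h3
  rw [h2] at h1
  have h5 : (x - p) - (x - q) = q - p := by abel
  rw [h5] at h3
  norm_num at h3
  have h6 : ‖q - p‖ = 0 := by
    norm_num at h1
    nlinarith [norm_nonneg (x - q), norm_nonneg (q - p)]
  exact (sub_eq_zero.mp (norm_eq_zero.mp h6)).symm

end Projection

end FormInvariance

/-! Invariance is encoded by a condition on the form alone: each `u` in `V` has a `w` in `V` that
represents the projection of `u` and satisfies `Re a(w, u - w) ≥ 0`. Since this inequality involves
only `a` and `V`, the relation `P ∘ j = j ∘ P̃` carries it from `H̃` to `H` with the same `w`.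
Invariance gives the condition (`exists_metricProj_eq`): the contractions `lam (lam + Ã)⁻¹` preserve
the convex set; applied to `P̃ u` they yield a family bounded in `V`, and a weak limit as `lam → ∞`
is the required `w`. Conversely (`infDist_semigroup_apply_le`), the condition and accretivity give
`Re (φ - P φ, A φ) ≥ 0` on `D(A)`, so the distance to the set does not increase along orbits; an
orbit starting in the set stays there. -/

namespace FormInvariance

/-! ### Nearest points of convex sets -/

section NearestPoint

variable {H : Type*} [NormedAddCommGroup H] [InnerProductSpace ℂ H] [CompleteSpace H]

/-- The variational inequality characterizing the nearest point of a convex set. -/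
theorem re_inner_sub_metricProj_nonpos {C : Set H} (hne : C.Nonempty) (hcl : IsClosed C)
    (hco : Convex ℝ C) (x : H) {y : H} (hy : y ∈ C) :
    (inner ℂ (x - metricProj C x) (y - metricProj C x)).re ≤ 0 := by
  let _ : InnerProductSpace ℝ H := InnerProductSpace.complexToReal
  obtain ⟨hp, hmin⟩ := metricProj_spec hne hcl hco x
  have : Nonempty C := ⟨⟨_, hp⟩⟩
  refine (norm_eq_iInf_iff_real_inner_le_zero hco hp).1 (le_antisymm ?_ ?_) y hy
  · exact le_ciInf fun z => hmin z z.2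
  · exact ciInf_le ⟨0, by rintro _ ⟨z, rfl⟩; exact norm_nonneg _⟩ (⟨_, hp⟩ : C)

theorem infDist_eq_norm_sub_metricProj {C : Set H} (hne : C.Nonempty) (hcl : IsClosed C)
    (hco : Convex ℝ C) (x : H) : Metric.infDist x C = ‖x - metricProj C x‖ := by
  obtain ⟨hp, hmin⟩ := metricProj_spec hne hcl hco x
  refine le_antisymm (dist_eq_norm x _ ▸ Metric.infDist_le_dist_of_mem hp) ?_
  exact (Metric.le_infDist hne).2 fun z hz => dist_eq_norm x z ▸ hmin z hz

end NearestPoint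

/-! ### Weak compactness -/

section WeakLimit

variable {V : Type*} [NormedAddCommGroup V] [InnerProductSpace ℂ V] [CompleteSpace V]

/-- A bounded family in a Hilbert space converges weakly along every ultrafilter. -/
theorem exists_weak_limit {ι : Type*} (𝒰 : Ultrafilter ι) (x : ι → V) (K : ℝ)
    (hx : ∀ n, ‖x n‖ ≤ K) :
    ∃ w : V, ∀ f : V →L[ℂ] ℂ, Tendsto (fun n => f (x n)) 𝒰 (𝓝 (f w)) := by
  -- Banach–Alaoglu, transported to `V` by the Riesz isomorphism. That map is conjugate-linear,
  -- hence the conjugations below.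
  have hc := WeakDual.isCompact_closedBall (𝕜 := ℂ) (E := V) 0 K
  let y : ι → WeakDual ℂ V := fun n => (InnerProductSpace.toDual ℂ V (x n)).toWeakDual
  obtain ⟨φ, -, hφ⟩ := hc.ultrafilter_le_nhds (𝒰.map y) (by
    rw [le_principal_iff]
    refine Filter.mem_map.2 (Filter.univ_mem' fun n => ?_)
    simp only [Set.mem_preimage, mem_closedBall_zero_iff]
    exact ((InnerProductSpace.toDual ℂ V).norm_map (x n)).le.trans (hx n))
  have hφ' : Tendsto y 𝒰 (𝓝 φ) := hφ
  refine ⟨(InnerProductSpace.toDual ℂ V).symm (WeakDual.toStrongDual φ), fun f => ?_⟩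
  obtain ⟨v, rfl⟩ := (InnerProductSpace.toDual ℂ V).surjective f
  have h1 : Tendsto (fun n => y n v) 𝒰 (𝓝 (φ v)) :=
    (WeakDual.eval_continuous v).continuousAt.tendsto.comp hφ'
  have h2 := (Complex.continuous_conj.tendsto (φ v)).comp h1
  have h3 : (InnerProductSpace.toDual ℂ V v)
      ((InnerProductSpace.toDual ℂ V).symm (WeakDual.toStrongDual φ))
      = (starRingEnd ℂ) (φ v) := by
    rw [InnerProductSpace.toDual_apply_apply, ← inner_conj_symm,
      InnerProductSpace.toDual_symm_apply]
    rfl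
  rw [h3]
  refine h2.congr fun n => ?_
  exact inner_conj_symm v (x n)

end WeakLimit

/-! ### Resolvents and dense domains -/

section Forms

variable {V : Type*} [NormedAddCommGroup V] [InnerProductSpace ℂ V] [CompleteSpace V]
variable {H : Type*} [NormedAddCommGroup H] [InnerProductSpace ℂ H]

/-- **Lax–Milgram** for the shifted form `a(u,v) + lam (j u, j v)`. -/
theorem exists_resolvent_solution {a : V →ₗ[ℂ] V →ₗ⋆[ℂ] ℂ} (hac : IsContinuousForm a)
    {j : V →L[ℂ] H} {ω μ : ℝ} (hμ : 0 < μ)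
    (hell : ∀ u : V, μ * ‖u‖ ^ 2 ≤ (a u u).re + ω * ‖j u‖ ^ 2)
    {lam : ℝ} (hlam : ω ≤ lam) (y : H) :
    ∃ u : V, ∀ v : V, a u v + lam * inner ℂ (j v) (j u) = inner ℂ (j v) y := by
  let _ : InnerProductSpace ℝ V := InnerProductSpace.complexToReal
  obtain ⟨M, -, hM⟩ := hac
  -- Lax–Milgram is applied to the real part of the shifted form, on `V` as a real Hilbert space.
  let B₀ : V →ₗ[ℝ] V →ₗ[ℝ] ℝ := LinearMap.mk₂ ℝ
    (fun u v => (a u v + lam * inner ℂ (j v) (j u)).re)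
    (fun u u' v => by simp; ring)
    (fun c u v => by
      rw [← Complex.coe_smul c u]; simp [-Complex.coe_smul, mul_left_comm]; ring)
    (fun u v v' => by simp; ring)
    (fun c u v => by
      rw [← Complex.coe_smul c v]; simp [-Complex.coe_smul]; ring)
  have hB₀ : ∀ u v, ‖B₀ u v‖ ≤ (M + |lam| * (‖j‖ * ‖j‖)) * ‖u‖ * ‖v‖ := fun u v => by
    have h1 : ‖(inner ℂ (j v) (j u) : ℂ)‖ ≤ (‖j‖ * ‖j‖) * ‖u‖ * ‖v‖ := by
      refine (norm_inner_le_norm _ _).trans ?_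
      calc ‖j v‖ * ‖j u‖ ≤ (‖j‖ * ‖v‖) * (‖j‖ * ‖u‖) := by gcongr <;> exact j.le_opNorm _
        _ = _ := by ring
    calc ‖B₀ u v‖ ≤ ‖a u v + lam * inner ℂ (j v) (j u)‖ :=
        Complex.abs_re_le_norm (a u v + lam * inner ℂ (j v) (j u))
      _ ≤ ‖a u v‖ + |lam| * ‖(inner ℂ (j v) (j u) : ℂ)‖ := by
        refine (norm_add_le _ _).trans_eq ?_
        rw [norm_mul, Complex.norm_real, Real.norm_eq_abs]
      _ ≤ M * ‖u‖ * ‖v‖ + |lam| * ((‖j‖ * ‖j‖) * ‖u‖ * ‖v‖) := by gcongr; exact hM u v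
      _ = _ := by ring
  let B : V →L[ℝ] V →L[ℝ] ℝ := B₀.mkContinuous₂ _ hB₀
  have hB : ∀ u v, B u v = (a u v + lam * inner ℂ (j v) (j u)).re := fun _ _ => rfl
  have hcoer : IsCoercive B := by
    refine ⟨μ, hμ, fun u => ?_⟩
    rw [hB, inner_self_eq_norm_sq_to_K]
    have h1 := hell u
    have h2 : (((lam : ℂ) * ((‖j u‖ : ℝ) : ℂ) ^ 2).re) = lam * ‖j u‖ ^ 2 := by norm_cast
    have h3 := mul_le_mul_of_nonneg_right hlam (sq_nonneg ‖j u‖)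
    rw [Complex.add_re]
    erw [h2]
    nlinarith
  obtain ⟨u, hu⟩ := hcoer.continuousLinearEquivOfBilin.surjective
    ((InnerProductSpace.toDual ℂ V).symm ((innerSL ℂ y).comp j))
  have hre : ∀ v, (a u v + lam * inner ℂ (j v) (j u)).re = (inner ℂ (j v) y : ℂ).re := fun v => by
    have h1 := hcoer.continuousLinearEquivOfBilin_apply u v
    rw [hu, hB] at h1
    rw [← h1]
    have h2 : (inner ℂ ((InnerProductSpace.toDual ℂ V).symm ((innerSL ℂ y).comp j)) v : ℂ)
        = inner ℂ y (j v) := by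
      rw [InnerProductSpace.toDual_symm_apply]; rfl
    change (inner ℂ ((InnerProductSpace.toDual ℂ V).symm ((innerSL ℂ y).comp j)) v : ℂ).re = _
    rw [h2]
    exact inner_re_symm (𝕜 := ℂ) _ _
  refine ⟨u, fun v => Complex.ext (hre v) ?_⟩
  -- Both sides are conjugate-linear in `v`, so the real parts at `I • v` are the imaginary parts at
  -- `v`.
  have h1 := hre (Complex.I • v)
  simpa [inner_smul_left] using h1

/-- The operator associated with `(a, j)` is densely defined. -/
theorem dense_domain [CompleteSpace H] {a : V →ₗ[ℂ] V →ₗ⋆[ℂ] ℂ} (hac : IsContinuousForm a)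
    {j : V →L[ℂ] H} (hj : DenseRange j) (hell : IsEllipticForm a j) :
    Dense {φ : H | ∃ ψ, IsAssociatedOperator a j φ ψ} := by
  let D : Submodule ℂ H :=
    { carrier := {φ : H | ∃ ψ, IsAssociatedOperator a j φ ψ}
      zero_mem' := ⟨0, 0, map_zero j, fun v => by simp⟩
      add_mem' := by
        rintro _ _ ⟨ψ, u, rfl, hu⟩ ⟨ψ', u', rfl, hu'⟩
        exact ⟨ψ + ψ', u + u', map_add .., fun v => by simp [hu, hu']⟩
      smul_mem' := by
        rintro c _ ⟨ψ, u, rfl, hu⟩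
        exact ⟨c • ψ, c • u, map_smul .., fun v => by simp [hu]⟩ }
  suffices h : D.topologicalClosure = ⊤ from Submodule.dense_iff_topologicalClosure_eq_top.2 h
  rw [Submodule.topologicalClosure_eq_top_iff, Submodule.eq_bot_iff]
  intro y hy
  obtain ⟨ω, μ, hμ, hell⟩ := hell
  -- For `y` orthogonal to the domain, test the equation with `u` itself: the right side vanishes,
  -- ellipticity forces `u = 0`, and then `y` is orthogonal to the range of `j`.
  obtain ⟨u, hu⟩ := exists_resolvent_solution hac hμ hell le_rfl y
  have hju : j u ∈ D := ⟨y - (ω : ℂ) • j u, u, rfl, fun v => by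
    rw [inner_sub_right, inner_smul_right, ← hu]; ring⟩
  have h1 : (inner ℂ (j u) y : ℂ) = 0 := (Submodule.mem_orthogonal D y).1 hy _ hju
  have h2 := congrArg Complex.re (hu u)
  rw [h1, inner_self_eq_norm_sq_to_K, Complex.add_re] at h2
  have h3 : (((ω : ℂ) * ((‖j u‖ : ℝ) : ℂ) ^ 2).re) = ω * ‖j u‖ ^ 2 := by norm_cast
  erw [h3] at h2
  have h4 : μ * ‖u‖ ^ 2 ≤ 0 := (hell u).trans_eq h2
  have h5 : u = 0 := by
    have : ‖u‖ ^ 2 ≤ 0 := by nlinarith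
    exact norm_eq_zero.1 (pow_eq_zero_iff two_ne_zero |>.1 (le_antisymm this (sq_nonneg _)))
  subst h5
  have h6 : (fun x : H => (inner ℂ x y : ℂ)) = fun _ => 0 := by
    refine hj.equalizer (by fun_prop) (by fun_prop) ?_
    funext v
    simpa using (hu v).symm
  exact inner_self_eq_zero.1 (congrFun h6 y)

end Forms

end FormInvariance

namespace FormInvariance

/-! ### Orbits, distances and resolvents -/

section Semigroups

variable {H : Type*} [NormedAddCommGroup H] [InnerProductSpace ℂ H]

/-- The semigroup maps the domain of its generator into itself and commutes with the generator. -/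
theorem IsGeneratorOf.apply {S : ℝ → H →L[ℂ] H} (hS : IsC0Semigroup S) {x y : H}
    (h : IsGeneratorOf S x y) {t : ℝ} (ht : 0 ≤ t) : IsGeneratorOf S (S t x) (S t y) := by
  refine (((S t).continuous.tendsto y).comp h).congr' ?_
  filter_upwards [self_mem_nhdsWithin] with s hs
  have h1 : S s (S t x) = S t (S s x) := by
    rw [← ContinuousLinearMap.comp_apply, ← hS.add s t (le_of_lt hs) ht, add_comm,
      hS.add t s ht (le_of_lt hs), ContinuousLinearMap.comp_apply]
  rw [Function.comp_apply, ← Complex.coe_smul, map_smul, map_sub, h1, Complex.coe_smul]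

/-- An orbit starting in the domain of the generator is right differentiable. -/
theorem IsGeneratorOf.hasDerivWithinAt {S : ℝ → H →L[ℂ] H} (hS : IsC0Semigroup S) {x y : H}
    (h : IsGeneratorOf S x y) {t : ℝ} (ht : 0 ≤ t) :
    HasDerivWithinAt (fun s => S s x) (S t y) (Set.Ioi t) t := by
  rw [hasDerivWithinAt_iff_tendsto_slope' (by simp)]
  have h1 : Tendsto (fun s : ℝ => s - t) (𝓝[>] t) (𝓝[>] 0) := by
    refine tendsto_nhdsWithin_iff.2 ⟨?_, ?_⟩
    · have : Tendsto (fun s : ℝ => s - t) (𝓝 t) (𝓝 (t - t)) :=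
        (continuous_id.sub continuous_const).tendsto t
      rw [sub_self] at this
      exact this.mono_left nhdsWithin_le_nhds
    · filter_upwards [self_mem_nhdsWithin] with s hs using Set.mem_Ioi.2 (sub_pos.2 hs)
  refine ((h.apply hS ht).comp h1).congr' ?_
  filter_upwards [self_mem_nhdsWithin] with s hs
  have h2 : S s x = S (s - t) (S t x) := by
    rw [← ContinuousLinearMap.comp_apply, ← hS.add _ _ (sub_nonneg.2 (le_of_lt hs)) ht,
      sub_add_cancel]
  rw [Function.comp_apply, slope_def_module, h2]

variable [CompleteSpace H]

/-- If the generator points (weakly) towards `C`, the distance to `C` decreases along orbits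
starting in the domain of the generator. -/
theorem infDist_apply_le_of_mem_domain {S : ℝ → H →L[ℂ] H} (hS : IsC0Semigroup S) {C : Set H}
    (hne : C.Nonempty) (hcl : IsClosed C) (hco : Convex ℝ C)
    (hdiss : ∀ x y : H, IsGeneratorOf S x y → (inner ℂ (x - metricProj C x) y).re ≤ 0)
    {x y : H} (hxy : IsGeneratorOf S x y) {t : ℝ} (ht : 0 ≤ t) :
    Metric.infDist (S t x) C ≤ Metric.infDist x C := by
  let _ : InnerProductSpace ℝ H := InnerProductSpace.complexToReal
  have key : Metric.infDist (S t x) C ^ 2 ≤ Metric.infDist x C ^ 2 := by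
    refine image_le_of_liminf_slope_right_le_deriv_boundary
      (f := fun s => Metric.infDist (S s x) C ^ 2) (a := 0) (b := t)
      (B := fun _ => Metric.infDist x C ^ 2) (B' := fun _ => 0)
      ?_ ?_ continuousOn_const (fun s _ => hasDerivWithinAt_const ..) ?_ ⟨ht, le_rfl⟩
    · exact ((Metric.continuous_infDist_pt C).comp_continuousOn
        ((hS.strongly_continuous x).mono Set.Icc_subset_Ici_self)).pow 2
    · rw [hS.zero, ContinuousLinearMap.id_apply]
    · intro s hs r hr
      -- Freezing the nearest point at time `s` gives a differentiable majorant of the squared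
      -- distance, with equality at `s` and nonpositive right derivative.
      set q := metricProj C (S s x)
      have hd : HasDerivWithinAt (fun z => ‖S z x - q‖ ^ 2) (2 * inner ℝ (S s x - q) (S s y))
          (Set.Ioi s) s := ((hxy.hasDerivWithinAt hS hs.1).sub_const q).norm_sq
      have hle : 2 * inner ℝ (S s x - q) (S s y) < r := by
        have : inner ℝ (S s x - q) (S s y) ≤ 0 := hdiss _ _ (hxy.apply hS hs.1)
        linarith
      rw [hasDerivWithinAt_iff_tendsto_slope' (by simp)] at hd
      refine Eventually.frequently ?_
      filter_upwards [hd.eventually_lt_const hle, self_mem_nhdsWithin] with z hz hsz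
      refine lt_of_le_of_lt ?_ hz
      rw [slope_def_field, slope_def_field]
      refine div_le_div_of_nonneg_right ?_ (sub_nonneg.2 (le_of_lt hsz))
      have h1 : Metric.infDist (S z x) C ≤ ‖S z x - q‖ := by
        rw [← dist_eq_norm]
        exact Metric.infDist_le_dist_of_mem (metricProj_spec hne hcl hco _).1
      have h2 : Metric.infDist (S s x) C = ‖S s x - q‖ :=
        infDist_eq_norm_sub_metricProj hne hcl hco _
      rw [h2]
      have := pow_le_pow_left₀ Metric.infDist_nonneg h1 2
      linarith
  exact le_of_sq_le_sq key Metric.infDist_nonneg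

variable {V : Type*} [NormedAddCommGroup V] [InnerProductSpace ℂ V] [CompleteSpace V]

/-- If `V` is mapped into itself by the projection onto `C` and `Re a(P u, u - P u) ≥ 0`, then the
distance to `C` decreases along the semigroup associated with an accretive form. -/
theorem infDist_semigroup_apply_le {a : V →ₗ[ℂ] V →ₗ⋆[ℂ] ℂ} (hac : IsContinuousForm a)
    (hacc : IsAccretiveForm a) {j : V →L[ℂ] H} (hj : DenseRange j) (hell : IsEllipticForm a j)
    {S : ℝ → H →L[ℂ] H} (hS : IsSemigroupGeneratedByNeg (IsAssociatedOperator a j) S)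
    {C : Set H} (hne : C.Nonempty) (hcl : IsClosed C) (hco : Convex ℝ C)
    (hC : ∀ u : V, ∃ w : V, metricProj C (j u) = j w ∧ 0 ≤ (a w (u - w)).re)
    (x : H) {t : ℝ} (ht : 0 ≤ t) : Metric.infDist (S t x) C ≤ Metric.infDist x C := by
  have hdiss : ∀ x y : H, IsGeneratorOf S x y → (inner ℂ (x - metricProj C x) y).re ≤ 0 := by
    intro x y hxy
    obtain ⟨u, rfl, hu⟩ := (hS.2 x y).1 hxy
    obtain ⟨w, hw, haw⟩ := hC u
    -- `Re a(u, u - w) = Re a(u - w, u - w) + Re a(w, u - w)`, and both terms are nonnegative.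
    have h1 := congrArg Complex.re (hu (u - w))
    have h2 := hacc (u - w)
    rw [map_sub a u w, LinearMap.sub_apply, Complex.sub_re] at h2
    rw [inner_neg_right, Complex.neg_re, map_sub j] at h1
    rw [hw]
    linarith
  refine (dense_domain hac hj hell).induction (P := fun x =>
    Metric.infDist (S t x) C ≤ Metric.infDist x C) ?_ ?_ x
  · rintro x ⟨y, hy⟩
    have hxy : IsGeneratorOf S x (-y) := (hS.2 _ _).2 (by rwa [neg_neg])
    exact infDist_apply_le_of_mem_domain hS.1 hne hcl hco hdiss hxy ht
  · exact isClosed_le ((Metric.continuous_infDist_pt C).comp (S t).continuous)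
      (Metric.continuous_infDist_pt C)

/-- The semigroup associated with an accretive form is contractive. -/
theorem norm_semigroup_apply_le {a : V →ₗ[ℂ] V →ₗ⋆[ℂ] ℂ} (hac : IsContinuousForm a)
    (hacc : IsAccretiveForm a) {j : V →L[ℂ] H} (hj : DenseRange j) (hell : IsEllipticForm a j)
    {S : ℝ → H →L[ℂ] H} (hS : IsSemigroupGeneratedByNeg (IsAssociatedOperator a j) S)
    (x : H) {t : ℝ} (ht : 0 ≤ t) : ‖S t x‖ ≤ ‖x‖ := by
  have h := infDist_semigroup_apply_le hac hacc hj hell hS (C := {0}) (Set.singleton_nonempty _)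
    isClosed_singleton (convex_singleton _) (fun u => ⟨0, ?_, by simp⟩) x ht
  · simpa using h
  · rw [map_zero]
    exact (metricProj_spec (Set.singleton_nonempty (0 : H)) isClosed_singleton
      (convex_singleton _) (j u)).1

/-- If `S` is a contraction semigroup leaving `C` invariant, then the resolvents of its generator,
normalized to contractions, leave `C` invariant. -/
theorem IsInvariantUnder.resolvent_mem {S : ℝ → H →L[ℂ] H}
    (hcontr : ∀ t, 0 ≤ t → ∀ x, ‖S t x‖ ≤ ‖x‖) {C : Set H} (hne : C.Nonempty)
    (hcl : IsClosed C) (hco : Convex ℝ C) (hinv : IsInvariantUnder C S) {lam : ℝ} (hlam : 0 < lam)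
    {p f : H} (hp : p ∈ C) (hf : IsGeneratorOf S f ((lam : ℂ) • (f - p))) : f ∈ C := by
  have hq := (metricProj_spec hne hcl hco f).1
  have hvar := fun {y} (hy : y ∈ C) => re_inner_sub_metricProj_nonpos hne hcl hco f hy
  set q := metricProj C f
  have h1 : (inner ℂ (f - q) ((lam : ℂ) • (f - p))).re ≤ 0 := by
    have hlim : Tendsto (fun t : ℝ => (inner ℂ (f - q) (t⁻¹ • (S t f - f)) : ℂ).re) (𝓝[>] 0)
        (𝓝 (inner ℂ (f - q) ((lam : ℂ) • (f - p))).re) :=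
      (Complex.continuous_re.tendsto _).comp (tendsto_const_nhds.inner hf)
    refine le_of_tendsto hlim ?_
    filter_upwards [self_mem_nhdsWithin] with t ht
    have ht' : 0 ≤ t := le_of_lt ht
    have h2 : (inner ℂ (f - q) (S t (f - q))).re ≤ ‖f - q‖ ^ 2 := by
      refine (Complex.re_le_norm _).trans ((norm_inner_le_norm _ _).trans ?_)
      rw [sq]
      exact mul_le_mul_of_nonneg_left (hcontr t ht' _) (norm_nonneg _)
    have h3 := hvar (hinv t ht' q hq)
    have h4 : (inner ℂ (f - q) (f - q) : ℂ).re = ‖f - q‖ ^ 2 := by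
      rw [inner_self_eq_norm_sq_to_K]; norm_cast
    -- Contractivity controls `S t (f - q) - (f - q)`; the variational inequality at `S t q ∈ C`
    -- controls the rest.
    have h5 : S t f - f = S t (f - q) + (S t q - q) - (f - q) := by rw [map_sub]; abel
    rw [← Complex.coe_smul, inner_smul_right, Complex.re_ofReal_mul]
    refine mul_nonpos_of_nonneg_of_nonpos (inv_nonneg.2 ht') ?_
    rw [h5, inner_sub_right, inner_add_right, Complex.sub_re, Complex.add_re, h4]
    linarith
  rw [inner_smul_right, Complex.re_ofReal_mul] at h1
  have h2 := nonpos_of_mul_nonpos_right h1 hlam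
  have h3 := hvar hp
  have h4 : (inner ℂ (f - q) (f - q) : ℂ).re = ‖f - q‖ ^ 2 := by
    rw [inner_self_eq_norm_sq_to_K]; norm_cast
  have h5 : f - p = (f - q) - (p - q) := by abel
  rw [h5, inner_sub_right, Complex.sub_re, h4] at h2
  have h6 : ‖f - q‖ = 0 := pow_eq_zero_iff two_ne_zero |>.1 (le_antisymm (by linarith) (sq_nonneg _))
  rw [sub_eq_zero.1 (norm_eq_zero.1 h6)]
  exact hq

end Semigroups

end FormInvariance

namespace FormInvariance

/-! ### From invariance to the form inequality -/

section Invariance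

variable {V : Type*} [NormedAddCommGroup V] [InnerProductSpace ℂ V] [CompleteSpace V]
variable {H : Type*} [NormedAddCommGroup H] [InnerProductSpace ℂ H] [CompleteSpace H]

/-- The resolvent approximations of `p = P (i u)`: elements `x` of `V` with `i x ∈ C` and
`Re a(x, u - x) ≥ lam ‖p - i x‖²`, bounded in `V` uniformly in `lam`. -/
theorem IsInvariantUnder.exists_approximation {a : V →ₗ[ℂ] V →ₗ⋆[ℂ] ℂ}
    (hac : IsContinuousForm a) (hacc : IsAccretiveForm a) {i : V →L[ℂ] H} (hi : DenseRange i)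
    (hell : IsEllipticForm a i) {S : ℝ → H →L[ℂ] H}
    (hS : IsSemigroupGeneratedByNeg (IsAssociatedOperator a i) S) {C : Set H}
    (hne : C.Nonempty) (hcl : IsClosed C) (hco : Convex ℝ C) (hinv : IsInvariantUnder C S)
    (u : V) : ∃ K lam₀ : ℝ, ∀ lam : ℝ, lam₀ ≤ lam → 0 < lam → ∃ x : V, ‖x‖ ≤ K ∧
      lam * ‖metricProj C (i u) - i x‖ ^ 2 ≤ (a x (u - x)).re := by
  obtain ⟨M, hM0, hM⟩ := hac
  obtain ⟨ω, μ, hμ, hω⟩ := hell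
  have hp := (metricProj_spec hne hcl hco (i u)).1
  have hvar := fun {y} (hy : y ∈ C) => re_inner_sub_metricProj_nonpos hne hcl hco (i u) hy
  set p := metricProj C (i u)
  refine ⟨1 + (M * ‖u‖ + |ω| * ‖p‖ ^ 2) / μ, ω, fun lam hlam hpos => ?_⟩
  -- Here `i x = lam (lam + A)⁻¹ p`.
  obtain ⟨x, hx⟩ := exists_resolvent_solution ⟨M, hM0, hM⟩ hμ hω hlam ((lam : ℂ) • p)
  have hax : ∀ v, a x v = lam * inner ℂ (i v) (p - i x) := fun v => by
    rw [inner_sub_right, mul_sub, ← inner_smul_right, ← hx]; ring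
  have hxC : i x ∈ C := by
    refine hinv.resolvent_mem
      (fun t ht y => norm_semigroup_apply_le ⟨M, hM0, hM⟩ hacc hi ⟨ω, μ, hμ, hω⟩ hS y ht)
      hne hcl hco hpos hp ((hS.2 _ _).2 ⟨x, rfl, fun v => ?_⟩)
    rw [hax, ← smul_neg, neg_sub, inner_smul_right]
  have hself : ∀ y : H, (inner ℂ y y : ℂ).re = ‖y‖ ^ 2 := fun y => by
    rw [inner_self_eq_norm_sq_to_K]; norm_cast
  have hmain : lam * ‖p - i x‖ ^ 2 ≤ (a x (u - x)).re := by
    rw [hax, Complex.re_ofReal_mul]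
    refine mul_le_mul_of_nonneg_left ?_ hpos.le
    have h1 : i (u - x) = (i u - p) + (p - i x) := by rw [map_sub]; abel
    have h2 := hvar hxC
    have h3 : p - i x = -(i x - p) := by abel
    rw [h1, inner_add_left, Complex.add_re, hself]
    have h4 : (inner ℂ (i u - p) (p - i x) : ℂ).re = -(inner ℂ (i u - p) (i x - p) : ℂ).re := by
      rw [h3, inner_neg_right, Complex.neg_re]
    linarith
  refine ⟨x, ?_, hmain⟩
  have hixp : ‖i x‖ ≤ ‖p‖ := by
    have h1 := hacc x
    rw [hax, Complex.re_ofReal_mul] at h1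
    have h2 := nonneg_of_mul_nonneg_right h1 hpos
    rw [inner_sub_right, Complex.sub_re, hself] at h2
    have h3 : (inner ℂ (i x) p : ℂ).re ≤ ‖i x‖ * ‖p‖ :=
      (Complex.re_le_norm _).trans (norm_inner_le_norm _ _)
    by_contra! hc
    nlinarith [norm_nonneg p, norm_nonneg (i x)]
  have h0 : 0 ≤ lam * ‖p - i x‖ ^ 2 := by positivity
  have h1 : (a x x).re ≤ M * ‖x‖ * ‖u‖ := by
    have h2 : (a x u).re ≤ M * ‖x‖ * ‖u‖ := (Complex.re_le_norm _).trans (hM x u)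
    rw [map_sub, Complex.sub_re] at hmain
    linarith
  have h2 : ω * ‖i x‖ ^ 2 ≤ |ω| * ‖p‖ ^ 2 :=
    mul_le_mul (le_abs_self ω) (pow_le_pow_left₀ (norm_nonneg _) hixp 2) (by positivity)
      (abs_nonneg ω)
  have h3 := hω x
  have hc0 : 0 ≤ |ω| * ‖p‖ ^ 2 := by positivity
  have hd0 : 0 ≤ M * ‖u‖ := by positivity
  -- Ellipticity gives `μ ‖x‖² ≤ M ‖x‖ ‖u‖ + |ω| ‖p‖²`. If `‖x‖ > 1`, the last term may be
  -- multiplied by `‖x‖`, and one factor cancels; the other case accounts for the `1` in the bound.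
  rcases le_or_gt ‖x‖ 1 with hx1 | hx1
  · exact hx1.trans (le_add_of_nonneg_right (by positivity))
  · have h4 : ‖x‖ * (μ * ‖x‖) ≤ ‖x‖ * (M * ‖u‖ + |ω| * ‖p‖ ^ 2) := by nlinarith
    have h5 := le_of_mul_le_mul_left h4 (by linarith)
    have h6 : ‖x‖ ≤ (M * ‖u‖ + |ω| * ‖p‖ ^ 2) / μ := by
      rw [le_div_iff₀ hμ]; linarith
    linarith

/-- Invariance of `C` under the semigroup of an accretive form implies that the projection `P`
onto `C` maps `V` into `V` and that `Re a(P u, u - P u) ≥ 0`. -/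
theorem IsInvariantUnder.exists_metricProj_eq {a : V →ₗ[ℂ] V →ₗ⋆[ℂ] ℂ}
    (hac : IsContinuousForm a) (hacc : IsAccretiveForm a) {i : V →L[ℂ] H} (hi : DenseRange i)
    (hell : IsEllipticForm a i) {S : ℝ → H →L[ℂ] H}
    (hS : IsSemigroupGeneratedByNeg (IsAssociatedOperator a i) S) {C : Set H}
    (hne : C.Nonempty) (hcl : IsClosed C) (hco : Convex ℝ C) (hinv : IsInvariantUnder C S)
    (u : V) : ∃ w : V, metricProj C (i u) = i w ∧ 0 ≤ (a w (u - w)).re := by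
  obtain ⟨K, lam₀, happ⟩ := hinv.exists_approximation hac hacc hi hell hS hne hcl hco u
  obtain ⟨M, hM0, hM⟩ := hac
  set p := metricProj C (i u)
  have happ' : ∀ n : ℕ, ∃ x : V, ‖x‖ ≤ K ∧
      ((n : ℝ) + 1) * ‖p - i x‖ ^ 2 ≤ (a x (u - x)).re := fun n => by
    obtain ⟨x, hx, hx'⟩ := happ (max lam₀ (n + 1)) (le_max_left _ _)
      (lt_max_of_lt_right (by positivity))
    exact ⟨x, hx, (mul_le_mul_of_nonneg_right (le_max_right _ _) (sq_nonneg _)).trans hx'⟩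
  choose x hxK hx using happ'
  have hxnn : ∀ n, 0 ≤ (a (x n) (u - x n)).re := fun n => le_trans (by positivity) (hx n)
  have hconv : Tendsto (fun n => i (x n)) atTop (𝓝 p) := by
    have hbd : ∀ n, ‖p - i (x n)‖ ^ 2 ≤ (M * K * ‖u‖) * (1 / ((n : ℝ) + 1)) := fun n => by
      have h1 : (a (x n) (u - x n)).re ≤ M * K * ‖u‖ := by
        have h2 := hacc (x n)
        have h3 : (a (x n) u).re ≤ M * ‖x n‖ * ‖u‖ := (Complex.re_le_norm _).trans (hM _ _)
        have h4 : M * ‖x n‖ * ‖u‖ ≤ M * K * ‖u‖ := by gcongr; exact hxK n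
        rw [map_sub, Complex.sub_re]
        linarith
      rw [mul_one_div, le_div_iff₀ (by positivity), mul_comm]
      exact (hx n).trans h1
    have hlim : Tendsto (fun n : ℕ => (M * K * ‖u‖) * (1 / ((n : ℝ) + 1))) atTop (𝓝 0) := by
      simpa using (tendsto_one_div_add_atTop_nhds_zero_nat (𝕜 := ℝ)).const_mul (M * K * ‖u‖)
    have hsq := squeeze_zero (fun n => sq_nonneg _) hbd hlim
    have h5 : Tendsto (fun n => ‖p - i (x n)‖) atTop (𝓝 0) := by
      simpa [Real.sqrt_sq] using hsq.sqrt
    rw [tendsto_iff_norm_sub_tendsto_zero]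
    exact h5.congr fun n => norm_sub_rev _ _
  let 𝒰 : Ultrafilter ℕ := hyperfilter ℕ
  have h𝒰 : (𝒰 : Filter ℕ) ≤ atTop := Nat.hyperfilter_le_atTop
  obtain ⟨w, hw⟩ := exists_weak_limit 𝒰 x K hxK
  have hiw : p = i w := by
    refine ext_inner_left ℂ fun y => ?_
    exact tendsto_nhds_unique (tendsto_const_nhds.inner (hconv.mono_left h𝒰))
      (hw ((innerSL ℂ y).comp i))
  refine ⟨w, hiw, ?_⟩
  have hfst : ∀ v, Tendsto (fun n => (a (x n) v).re) 𝒰 (𝓝 (a w v).re) := fun v => by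
    let f : V →L[ℂ] ℂ := (a.flip v).mkContinuous (M * ‖v‖) fun z => by
      rw [mul_right_comm]; exact hM z v
    exact (Complex.continuous_re.tendsto _).comp (hw f)
  have hsnd : Tendsto (fun n => (a w (x n)).re) 𝒰 (𝓝 (a w w).re) := by
    let f : V →L[ℂ] ℂ := LinearMap.mkContinuous
      { toFun := fun v => (starRingEnd ℂ) (a w v)
        map_add' := fun v v' => by simp
        map_smul' := fun c v => by simp } (M * ‖w‖) fun v => by
      simpa using hM w v
    exact ((Complex.continuous_re.tendsto _).comp (hw f)).congr fun n => Complex.conj_re _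
  have hlim : Tendsto (fun n => (a (x n) u).re - (a (x n) w).re - (a w (x n)).re) 𝒰
      (𝓝 ((a w u).re - (a w w).re - (a w w).re)) := ((hfst u).sub (hfst w)).sub hsnd
  -- The quadratic term `a(x n, x n)` need not converge weakly; accretivity at `x n - w` bounds it
  -- below by terms linear in `x n`, which do.
  have hge := ge_of_tendsto' (b := -(a w w).re) hlim fun n => by
    have h1 := hacc (x n - w)
    have h2 := hxnn n
    simp only [map_sub, LinearMap.sub_apply, Complex.sub_re] at h1 h2
    linarith
  rw [map_sub, Complex.sub_re]
  linarith

end Invariance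

end FormInvariance

theorem proposition3p3
    {Ht V H : Type*}
    [NormedAddCommGroup Ht] [InnerProductSpace ℂ Ht] [CompleteSpace Ht]
    [NormedAddCommGroup V] [InnerProductSpace ℂ V] [CompleteSpace V]
    [NormedAddCommGroup H] [InnerProductSpace ℂ H] [CompleteSpace H]
    -- the continuous and dense embedding of `V` into `Ht`
    (i : V →L[ℂ] Ht) (hi_inj : Function.Injective i) (hi_dense : DenseRange i)
    -- the continuous, quasi-coercive form and its semigroup on `Ht`
    (a : V →ₗ[ℂ] V →ₗ⋆[ℂ] ℂ)
    (ha_cont : FormInvariance.IsContinuousForm a)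
    (ha_coer : FormInvariance.IsEllipticForm a i)
    (St : ℝ → Ht →L[ℂ] Ht)
    (hSt : FormInvariance.IsSemigroupGeneratedByNeg
      (FormInvariance.IsAssociatedOperator a i) St)
    -- the bounded map `j` with dense range, and the semigroup associated with `(a, j)` on `H`
    (j : V →L[ℂ] H) (hj_dense : DenseRange j)
    (ha_accr : FormInvariance.IsAccretiveForm a)
    (ha_ell : FormInvariance.IsEllipticForm a j)
    (S : ℝ → H →L[ℂ] H)
    (hS : FormInvariance.IsSemigroupGeneratedByNeg
      (FormInvariance.IsAssociatedOperator a j) S)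
    -- the closed convex sets
    (Ct : Set Ht) (hCt_ne : Ct.Nonempty) (hCt_closed : IsClosed Ct) (hCt_conv : Convex ℝ Ct)
    (C : Set H) (hC_ne : C.Nonempty) (hC_closed : IsClosed C) (hC_conv : Convex ℝ C)
    (hCt_inv : FormInvariance.IsInvariantUnder Ct St)
    -- `P ∘ j = j ∘ Pt` on `V`
    (hP : ∀ u w : V, FormInvariance.metricProj Ct (i u) = i w →
      FormInvariance.metricProj C (j u) = j w) :
    FormInvariance.IsInvariantUnder C S := by
  have hC : ∀ u : V, ∃ w : V, FormInvariance.metricProj C (j u) = j w ∧ 0 ≤ (a w (u - w)).re := by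
    intro u
    obtain ⟨w, hw, haw⟩ := hCt_inv.exists_metricProj_eq ha_cont ha_accr hi_dense ha_coer hSt
      hCt_ne hCt_closed hCt_conv u
    exact ⟨w, hP u w hw, haw⟩
  intro t ht x hx
  rw [hC_closed.mem_iff_infDist_zero hC_ne]
  refine le_antisymm ?_ Metric.infDist_nonneg
  exact (FormInvariance.infDist_semigroup_apply_le ha_cont ha_accr hj_dense ha_ell hS
    hC_ne hC_closed hC_conv hC x ht).trans_eq (Metric.infDist_zero_of_mem hx)
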